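/- Let $k$ be a field, let $D$ be a semisimple $k$-algebra which is finitely generated as a module over its centre $K$, and let $\sigma$ be a $k$-algebra automorphism of $D$. Let $D[t;\sigma]=\bigoplus_{n\ge 0} D\,t^n$ be the skew polynomial ring, in which $t d=\sigma(d)t$ for $d\in D$, graded by the degree in $t$. Let $A$ be a graded $k$-subalgebra of $D[t;\sigma]$, i.e. $A=\bigoplus_n (A\cap D\,t^n)$, which is semiprime and (left and right) noetherian as a ring, and let $X$ be the set of homogeneous regular elements (non-zero-divisors) of $A$. Suppose that $A$ has a graded quotient ring with respect to $X$, i.e. that $X$ satisfies the right Ore condition: for all $a\in A$ and $x\in X$ there are $b\in A$ and $y\in X$ with $ay=xb$. Then $A$ is birationally PI: the degree zero part $$Q(A)_0=\{a x^{-1} : a\in A_n,\ x\in A_n\cap X,\ n\ge 0\}$$ of the graded quotient ring $Q(A)=AX^{-1}$ is a PI algebra, that is, it satisfies a nonzero polynomial identity with coefficients in $k$ in noncommuting variables. -/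

import Mathlib

universe u

noncomputable section

/-! ## Skew polynomial rings -/

section SkewPolynomialRing

variable {k D : Type*} [Field k] [Ring D] [Algebra k D]

/-- The action of the monoid `ℕ` (written multiplicatively) on `D` in which `n` acts as `σ ^ n`. -/
@[reducible]
def powersAction (σ : D ≃ₐ[k] D) : MulSemiringAction (Multiplicative ℕ) D :=
  MulSemiringAction.compHom D (powersHom (D ≃ₐ[k] D) σ)

/-- The skew polynomial ring `D[t;σ]`, with elements the left polynomials `∑ dₙ tⁿ` and with
multiplication determined by `t d = σ(d) t`: Mathlib's `SkewPolynomial` for the action of the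
powers of `σ`. -/
def SkewPolyRing (_σ : D ≃ₐ[k] D) := SkewPolynomial D

namespace SkewPolyRing

variable (σ : D ≃ₐ[k] D)

instance : Ring (SkewPolyRing σ) :=
  letI := powersAction σ
  (inferInstance : Ring (SkewPolynomial D))

instance : Algebra k (SkewPolyRing σ) :=
  letI := powersAction σ
  haveI : SMulCommClass (Multiplicative ℕ) k D :=
    ⟨fun n c d => map_smul (powersHom (D ≃ₐ[k] D) σ n) c d⟩
  (inferInstance : Algebra k (SkewPolynomial D))

/-- The element `d tⁿ` of `D[t;σ]`. -/
def monomial (n : ℕ) (d : D) : SkewPolyRing σ := SkewPolynomial.monomial n d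

theorem monomial_mul_monomial (m n : ℕ) (c d : D) :
    monomial σ m c * monomial σ n d = monomial σ (m + n) (c * (σ ^ m) d) := by
  let _ := powersAction σ
  have h := SkewPolynomial.monomial_mul_monomial m n c d
  rw [SkewPolynomial.φ_iterate_apply] at h
  exact h

theorem monomial_add (n : ℕ) (c d : D) :
    monomial σ n (c + d) = monomial σ n c + monomial σ n d :=
  SkewPolynomial.monomial_add n c d

theorem smul_monomial (n : ℕ) (c : k) (d : D) :
    c • monomial σ n d = monomial σ n (c • d) :=
  SkewPolynomial.smul_monomial n c d

/-- The homogeneous component `D tⁿ` of degree `n` of `D[t;σ]`. -/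
def homogeneousPart (n : ℕ) : Submodule k (SkewPolyRing σ) where
  carrier := Set.range (monomial σ n)
  add_mem' := by
    rintro _ _ ⟨c, rfl⟩ ⟨d, rfl⟩
    exact ⟨c + d, monomial_add σ n c d⟩
  zero_mem' := ⟨0, SkewPolynomial.monomial_zero_right n⟩
  smul_mem' := by
    rintro c _ ⟨d, rfl⟩
    exact ⟨c • d, (smul_monomial σ n c d).symm⟩

/-- For a subalgebra `A` of `D[t;σ]`, the piece `A ∩ D tⁿ`, as a subspace of `A`. The subalgebra
`A` is a graded subalgebra if and only if it is graded by these pieces, i.e. `A = ⨁ₙ (A ∩ D tⁿ)`. -/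
def gradedPiece {σ : D ≃ₐ[k] D} (A : Subalgebra k (SkewPolyRing σ)) (n : ℕ) : Submodule k A :=
  (homogeneousPart σ n).comap A.val.toLinearMap

end SkewPolyRing

end SkewPolynomialRing

/-! ## Ring-theoretic notions -/

/-- A ring is semiprime if it has no nonzero (two-sided) ideal `I` with `I ^ 2 = 0`; products of
ideals being generated by products of elements, this says that `x y = 0` for all `x, y ∈ I` forces
`I = 0`. -/
def IsSemiprimeRing (R : Type*) [Ring R] : Prop :=
  ∀ I : TwoSidedIdeal R, (∀ x ∈ I, ∀ y ∈ I, x * y = 0) → I = ⊥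

/-- A ring is noetherian if it is left and right noetherian. -/
def IsTwoSidedNoetherianRing (R : Type*) [Ring R] : Prop :=
  IsNoetherianRing R ∧ IsNoetherianRing Rᵐᵒᵖ

/-- A `k`-algebra is PI if it satisfies a polynomial identity: some nonzero polynomial over `k` in
noncommuting variables vanishes under all substitutions of elements of the algebra. -/
def IsPIAlgebra (k R : Type*) [Field k] [Ring R] [Algebra k R] : Prop :=
  ∃ p : FreeAlgebra k ℕ, p ≠ 0 ∧ ∀ v : ℕ → R, FreeAlgebra.lift k v p = 0

/-! ## The graded quotient ring -/

section GradedQuotientRing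

variable {k A : Type*} [Field k] [Ring A] [Algebra k A]

/-- The multiplicative set of homogeneous regular elements of a graded algebra. -/
def homogeneousRegular (𝒜 : ℕ → Submodule k A) [GradedAlgebra 𝒜] : Submonoid A where
  carrier := {x | SetLike.IsHomogeneousElem 𝒜 x ∧ x ∈ nonZeroDivisors A}
  one_mem' := ⟨⟨0, SetLike.GradedOne.one_mem⟩, one_mem _⟩
  mul_mem' := by
    rintro x y ⟨⟨m, hm⟩, hx⟩ ⟨⟨n, hn⟩, hy⟩
    exact ⟨⟨m + n, SetLike.GradedMul.mul_mem hm hn⟩, mul_mem hx hy⟩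

/-- The right Ore condition on a multiplicative set `X`: any `a ∈ A` and `x ∈ X` have a common
right multiple `a y = x b` with `y ∈ X`. -/
def IsRightOre (X : Submonoid A) : Prop :=
  ∀ a : A, ∀ x ∈ X, ∃ b : A, ∃ y ∈ X, a * y = x * b

variable {Q : Type*} [Ring Q] [Algebra k Q]

/-- `ι : A → Q` exhibits `Q` as the graded quotient ring `A X⁻¹` of `A`, where `X` is the set of
homogeneous regular elements of `A`: the map `ι` is injective, it makes all elements of `X`
invertible, and every element of `Q` is of the form `a x⁻¹`. -/
structure IsGradedQuotientRing (𝒜 : ℕ → Submodule k A) [GradedAlgebra 𝒜] (ι : A →ₐ[k] Q) :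
    Prop where
  injective : Function.Injective ι
  isUnit : ∀ x ∈ homogeneousRegular 𝒜, IsUnit (ι x)
  surj : ∀ q : Q, ∃ a : A, ∃ x ∈ homogeneousRegular 𝒜, q * ι x = ι a

namespace IsGradedQuotientRing

variable {𝒜 : ℕ → Submodule k A} [GradedAlgebra 𝒜] {ι : A →ₐ[k] Q}

/-- A homogeneous form of the right Ore condition: if `x ∈ X` has degree `n` and `a` has degree
`m`, then `a y = x b` with `y ∈ X` of some degree `j` and `b` of degree `m + j - n`. -/
theorem exists_ore (h : IsGradedQuotientRing 𝒜 ι) {m n : ℕ} {a x : A} (ha : a ∈ 𝒜 m)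
    (hx : x ∈ 𝒜 n) (hxX : x ∈ homogeneousRegular 𝒜) :
    ∃ j : ℕ, ∃ b : A, ∃ y ∈ 𝒜 j, y ∈ homogeneousRegular 𝒜 ∧ a * y = x * b ∧
      ∀ c ∈ 𝒜 n, c * b ∈ 𝒜 (m + j) := by
  obtain ⟨u, hu⟩ := h.isUnit x hxX
  obtain ⟨b, y, hyX, hb⟩ := h.surj (↑u⁻¹ * ι a)
  have hay : a * y = x * b := by
    apply h.injective
    rw [map_mul, map_mul, hb.symm, hu.symm]
    simp [← mul_assoc]
  obtain ⟨j, hy⟩ := hyX.1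
  have hayj : x * b ∈ 𝒜 (m + j) := hay ▸ SetLike.GradedMul.mul_mem ha hy
  refine ⟨j, b, y, hy, hyX, hay, fun c hc => ?_⟩
  classical
  have key : ∀ i, n + i ≠ m + j → (DirectSum.decompose 𝒜 b i : A) = 0 := by
    intro i hi
    refine hxX.2.1 _ ?_
    rw [← DirectSum.coe_decompose_mul_add_of_left_mem 𝒜 hx]
    exact DirectSum.decompose_of_mem_ne 𝒜 hayj hi.symm
  rw [← DirectSum.sum_support_decompose 𝒜 b, Finset.mul_sum]
  refine Submodule.sum_mem _ fun i _ => ?_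
  by_cases hi : n + i = m + j
  · rw [← hi]
    exact SetLike.GradedMul.mul_mem hc (SetLike.coe_mem _)
  · rw [key i hi, mul_zero]
    exact zero_mem _

/-- The degree zero part of the graded quotient ring: the elements `a x⁻¹` with `a` and `x`
homogeneous of the same degree and `x` regular. -/
def degreeZero (h : IsGradedQuotientRing 𝒜 ι) : Subalgebra k Q where
  carrier := {q | ∃ n : ℕ, ∃ a ∈ 𝒜 n, ∃ x ∈ 𝒜 n, x ∈ homogeneousRegular 𝒜 ∧ q * ι x = ι a}
  mul_mem' := by
    rintro q r ⟨m, a, ha, x, hx, hxX, hq⟩ ⟨n, b, hb, y, hy, hyX, hr⟩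
    obtain ⟨j, c, z, hz, hzX, hc, hdeg⟩ := h.exists_ore hb hx hxX
    refine ⟨n + j, a * c, hdeg a ha, y * z, SetLike.GradedMul.mul_mem hy hz,
      mul_mem hyX hzX, ?_⟩
    calc q * r * ι (y * z) = q * (r * ι y) * ι z := by rw [map_mul]; simp only [mul_assoc]
      _ = q * ι (b * z) := by rw [hr, map_mul, mul_assoc]
      _ = ι (a * c) := by rw [hc, map_mul, ← mul_assoc, hq, map_mul]
  add_mem' := by
    rintro q r ⟨m, a, ha, x, hx, hxX, hq⟩ ⟨n, b, hb, y, hy, hyX, hr⟩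
    obtain ⟨j, c, z, hz, hzX, hc, hdeg⟩ := h.exists_ore hy hx hxX
    refine ⟨n + j, a * c + b * z, add_mem (hdeg a ha) (SetLike.GradedMul.mul_mem hb hz), y * z,
      SetLike.GradedMul.mul_mem hy hz, mul_mem hyX hzX, ?_⟩
    rw [add_mul, map_add]
    congr 1
    · rw [hc, map_mul, ← mul_assoc, hq, map_mul]
    · rw [map_mul, ← mul_assoc, hr, map_mul]
  algebraMap_mem' c :=
    ⟨0, algebraMap k A c, SetLike.algebraMap_mem_graded 𝒜 c, 1, SetLike.GradedOne.one_mem,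
      one_mem _, by rw [map_one, mul_one, AlgHom.commutes]⟩

end IsGradedQuotientRing

end GradedQuotientRing

/-- A graded algebra `A` is birationally PI if it has a graded quotient ring `Q(A) = A X⁻¹`, with
`X` the homogeneous regular elements, and the degree zero part `Q(A)₀` is PI. (The graded quotient
ring is unique up to a unique isomorphism over `A`.) -/
def IsBirationallyPI {k : Type*} {A : Type u} [Field k] [Ring A] [Algebra k A]
    (𝒜 : ℕ → Submodule k A) [GradedAlgebra 𝒜] : Prop :=
  ∃ (Q : Type u) (_ : Ring Q) (_ : Algebra k Q) (ι : A →ₐ[k] Q)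
    (h : IsGradedQuotientRing 𝒜 ι), IsPIAlgebra k h.degreeZero

end

/-! Let `X` be the set of homogeneous regular elements. Choose `n` such that `D tⁿ` modulo its
`X`-torsion has maximal length as a left `D`-module. If `y ∈ X` has degree `p`, then right
multiplication by `y` embeds `D tⁿ` modulo torsion into `D tⁿ⁺ᵖ` modulo torsion, and by the choice
of `n` this embedding is an isomorphism. It follows that for every `q = a x⁻¹ ∈ Q(A)₀` there is
`d ∈ D` with `tⁿ q = d tⁿ`, that is, `tⁿ a = d tⁿ x` up to torsion. The pairs `(d, q)` satisfying
this relation form a subalgebra of `D × Q(A)`, which embeds in `D` because `tⁿ` is left regular, and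
whose projection to `Q(A)` contains `Q(A)₀`. So `Q(A)₀` is a subquotient of `D` and inherits its
polynomial identities; a standard identity holds in `D` because an alternating map in more variables
than there are generators vanishes. -/

section PolynomialIdentities

theorem map_freeAlgebraLift {k X R S : Type*} [CommSemiring k] [Semiring R] [Algebra k R]
    [Semiring S] [Algebra k S] (f : R →ₐ[k] S) (v : X → R) (p : FreeAlgebra k X) :
    f (FreeAlgebra.lift k v p) = FreeAlgebra.lift k (f ∘ v) p :=
  DFunLike.congr_fun (FreeAlgebra.hom_ext (by ext; simp) :
    f.comp (FreeAlgebra.lift k v) = FreeAlgebra.lift k (f ∘ v)) p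

namespace IsPIAlgebra

variable {k R S : Type*} [Field k] [Ring R] [Algebra k R] [Ring S] [Algebra k S]

theorem of_injective (f : R →ₐ[k] S) (hf : Function.Injective f) (hS : IsPIAlgebra k S) :
    IsPIAlgebra k R := by
  obtain ⟨p, hp, hpS⟩ := hS
  exact ⟨p, hp, fun v => (map_eq_zero_iff f hf).1 <| by rw [map_freeAlgebraLift, hpS]⟩

theorem of_surjective (f : R →ₐ[k] S) (hf : Function.Surjective f) (hR : IsPIAlgebra k R) :
    IsPIAlgebra k S := by
  obtain ⟨p, hp, hpR⟩ := hR
  refine ⟨p, hp, fun v => ?_⟩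
  obtain ⟨w, rfl⟩ := hf.comp_left v
  rw [← map_freeAlgebraLift, hpR, map_zero]

end IsPIAlgebra

/-- The standard polynomial `∑ sign(π) x_{π 0} ⋯ x_{π (n - 1)}` in noncommuting variables. -/
noncomputable def standardPolynomial (k : Type*) [CommRing k] (n : ℕ) : FreeAlgebra k ℕ :=
  ∑ π : Equiv.Perm (Fin n),
    ((Equiv.Perm.sign π : ℤ) : k) • (List.ofFn fun i => FreeAlgebra.ι k (π i : ℕ)).prod

theorem equivMonoidAlgebraFreeMonoid_prod_ofFn_ι {k X : Type*} [CommSemiring k] {n : ℕ}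
    (x : Fin n → X) :
    FreeAlgebra.equivMonoidAlgebraFreeMonoid (List.ofFn fun i => FreeAlgebra.ι k (x i)).prod =
      MonoidAlgebra.single (FreeMonoid.ofList (List.ofFn x)) (1 : k) := by
  rw [← AlgEquiv.eq_symm_apply]
  simp [FreeAlgebra.equivMonoidAlgebraFreeMonoid, FreeMonoid.lift_apply, List.map_ofFn,
    Function.comp_def]

theorem finVal_comp_perm_eq_finVal_iff {n : ℕ} (π : Equiv.Perm (Fin n)) :
    (fun i => (π i : ℕ)) = (fun i : Fin n => (i : ℕ)) ↔ π = 1 := by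
  rw [funext_iff, Equiv.ext_iff]
  simp only [Fin.val_inj, Equiv.Perm.one_apply]

theorem coeff_standardPolynomial (k : Type*) [CommRing k] (n : ℕ) :
    (FreeAlgebra.equivMonoidAlgebraFreeMonoid (standardPolynomial k n)).coeff
      (FreeMonoid.ofList (List.ofFn fun i : Fin n => (i : ℕ))) = 1 := by
  classical
  simp [standardPolynomial, equivMonoidAlgebraFreeMonoid_prod_ofFn_ι,
    Finsupp.single_apply, finVal_comp_perm_eq_finVal_iff]

theorem standardPolynomial_ne_zero (k : Type*) [CommRing k] [Nontrivial k] (n : ℕ) :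
    standardPolynomial k n ≠ 0 := by
  intro h
  simpa [h] using coeff_standardPolynomial k n

theorem lift_standardPolynomial {k : Type*} (R : Type*) {D : Type*} [CommRing k] [CommRing R]
    [Ring D] [Algebra k D] [Algebra R D] (n : ℕ) (v : ℕ → D) :
    FreeAlgebra.lift k v (standardPolynomial k n) =
      MultilinearMap.alternatization (MultilinearMap.mkPiAlgebraFin R n D) fun i => v i := by
  simp [standardPolynomial, MultilinearMap.alternatization_apply, List.map_ofFn,
    Function.comp_def, map_list_prod, Units.smul_def, Int.cast_smul_eq_zsmul]

theorem alternatingMap_eq_zero_of_span {R M N : Type*} [CommRing R] [AddCommGroup M] [Module R M]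
    [AddCommGroup N] [Module R N] {m n : ℕ} (hmn : m < n) {g : Fin m → M}
    (hg : Submodule.span R (Set.range g) = ⊤) (f : M [⋀^Fin n]→ₗ[R] N) : f = 0 := by
  apply exteriorPower.alternatingMapLinearEquiv.injective
  refine LinearMap.ext_on_range (exteriorPower.ιMulti_family_span_of_span R hg) fun s => ?_
  have hs : n ≤ m := by simpa [s.2] using Finset.card_le_univ s.1
  exact absurd hs hmn.not_ge

theorem IsPIAlgebra.of_module_finite (k R : Type*) {D : Type*} [Field k] [CommRing R] [Ring D]
    [Algebra k D] [Algebra R D] [Module.Finite R D] : IsPIAlgebra k D := by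
  obtain ⟨m, g, hg⟩ := Module.Finite.exists_fin (R := R) (M := D)
  refine ⟨standardPolynomial k (m + 1), standardPolynomial_ne_zero k _, fun v => ?_⟩
  have halt := alternatingMap_eq_zero_of_span m.lt_succ_self hg
    (MultilinearMap.alternatization (MultilinearMap.mkPiAlgebraFin R (m + 1) D))
  rw [lift_standardPolynomial R, halt, AlternatingMap.zero_apply]

theorem IsPIAlgebra.of_finite_center (k D : Type*) [Field k] [Ring D] [Algebra k D]
    [hfin : Module.Finite (Subalgebra.center k D) D] : IsPIAlgebra k D :=
  have : Module.Finite (Subring.center D) D := hfin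
  .of_module_finite k (Subring.center D)

end PolynomialIdentities

section Length

variable {R M N : Type*} [Ring R] [AddCommGroup M] [Module R M] [AddCommGroup N] [Module R N]

theorem exists_forall_length_quotient_le [IsArtinian R M] [IsNoetherian R M] {I : Type*}
    [Nonempty I] (T : I → Submodule R M) :
    ∃ i, ∀ j, Module.length R (M ⧸ T j) ≤ Module.length R (M ⧸ T i) := by
  have hbound : ⨆ i, Module.length R (M ⧸ T i) ≤ Module.length R M :=
    iSup_le fun i => Module.length_le_of_surjective _ (T i).mkQ_surjective
  obtain ⟨i, hi⟩ := ENat.exists_eq_iSup_of_lt_top (hbound.trans_lt Module.length_ne_top.lt_top)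
  exact ⟨i, fun j => hi ▸ le_iSup (fun i => Module.length R (M ⧸ T i)) j⟩

theorem surjective_of_length_le_length_quotient_ker [IsArtinian R N] [IsNoetherian R N]
    (f : M →ₗ[R] N) (h : Module.length R N ≤ Module.length R (M ⧸ LinearMap.ker f)) :
    Function.Surjective f := by
  by_contra hf
  have hlt := Submodule.length_lt (mt LinearMap.range_eq_top.1 hf)
  exact (h.trans_eq f.quotKerEquivRange.length_eq).not_gt hlt

end Length

section RightOre

namespace IsRightOre

section Localization

variable {A : Type u} [Ring A] {X : Submonoid A}

theorem nonempty_oreSet_op (hX : IsRightOre X) (hreg : X ≤ nonZeroDivisorsLeft A) :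
    Nonempty (OreLocalization.OreSet X.op) := by
  refine OreLocalization.nonempty_oreSet_iff.2 ⟨fun a b s hab => ⟨s, ?_⟩, fun a s => ?_⟩
  · have hcancel : s.1.unop * (a.unop - b.unop) = 0 := by
      rw [mul_sub, sub_eq_zero]
      exact congrArg MulOpposite.unop hab
    rw [MulOpposite.unop_injective (sub_eq_zero.1 (hreg s.2 _ hcancel))]
  · obtain ⟨b, y, hy, hb⟩ := hX a.unop s.1.unop s.2
    exact ⟨MulOpposite.op b, ⟨MulOpposite.op y, hy⟩, MulOpposite.unop_injective hb⟩

-- Mathlib localizes at left Ore sets, so the ring of right fractions is formed in `Aᵐᵒᵖ`.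
theorem exists_algHom_rightFractions (k : Type*) [CommRing k] [Algebra k A] (hX : IsRightOre X)
    (hreg : X ≤ nonZeroDivisors A) :
    ∃ (Q : Type u) (_ : Ring Q) (_ : Algebra k Q) (ι : A →ₐ[k] Q), Function.Injective ι ∧
      (∀ x ∈ X, IsUnit (ι x)) ∧ ∀ q : Q, ∃ a, ∃ x ∈ X, q * ι x = ι a := by
  obtain ⟨_⟩ := hX.nonempty_oreSet_op fun x hx => (hreg hx).1
  let num : Aᵐᵒᵖ →ₐ[k] OreLocalization X.op Aᵐᵒᵖ :=
    { OreLocalization.numeratorRingHom with commutes' := fun _ => rfl }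
  refine ⟨(OreLocalization X.op Aᵐᵒᵖ)ᵐᵒᵖ, inferInstance, inferInstance, AlgHom.opComm.symm num,
    ?_, fun x hx => ?_, fun q => ?_⟩
  · have hnum : Function.Injective num := OreLocalization.numeratorHom_inj fun x hx y hxy =>
      MulOpposite.unop_injective ((hreg hx).2 _ (congrArg MulOpposite.unop hxy))
    exact MulOpposite.op_injective.comp (hnum.comp MulOpposite.op_injective)
  · exact (OreLocalization.numerator_isUnit (S := X.op) ⟨MulOpposite.op x, hx⟩).op
  · induction q using MulOpposite.rec' with | _ q
    induction q using OreLocalization.ind with | _ a x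
    refine ⟨a.unop, x.1.unop, x.2, MulOpposite.unop_injective ?_⟩
    change OreLocalization.numeratorHom (x : Aᵐᵒᵖ) * (a /ₒ x) = OreLocalization.numeratorHom a
    rw [OreLocalization.numeratorHom_apply, OreLocalization.numeratorHom_apply,
      OreLocalization.mul_cancel]

end Localization

section Intertwiner

variable {k A B D Q : Type*} [CommRing k] [Ring A] [Algebra k A] [Ring B] [Algebra k B]
  [Ring D] [Algebra k D] [Ring Q] [Algebra k Q] {X : Submonoid A}

/-- The left ideal of the elements of `B` annihilated on the right by an element of a right Ore
set `X` of `A`, where `B` is a right `A`-module through `φ`. -/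
def torsion (hX : IsRightOre X) (φ : A →ₐ[k] B) : Submodule B B where
  carrier := {b | ∃ z ∈ X, b * φ z = 0}
  add_mem' := by
    rintro b c ⟨y, hy, hb⟩ ⟨z, hz, hc⟩
    obtain ⟨w, u, hu, hyu⟩ := hX y z hz
    refine ⟨y * u, mul_mem hy hu, ?_⟩
    calc (b + c) * φ (y * u) = b * φ y * φ u + c * φ z * φ w := by
          rw [add_mul, mul_assoc, mul_assoc, ← map_mul, ← map_mul, hyu]
      _ = 0 := by rw [hb, hc, zero_mul, zero_mul, add_zero]
  zero_mem' := ⟨1, one_mem _, zero_mul _⟩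
  smul_mem' := by
    rintro c b ⟨z, hz, hb⟩
    exact ⟨z, hz, by rw [smul_eq_mul, mul_assoc, hb, mul_zero]⟩

theorem mul_mem_torsion_iff (hX : IsRightOre X) (φ : A →ₐ[k] B) {y : A} (hy : y ∈ X) {b : B} :
    b * φ y ∈ hX.torsion φ ↔ b ∈ hX.torsion φ := by
  constructor
  · rintro ⟨z, hz, hb⟩
    exact ⟨y * z, mul_mem hy hz, by rw [map_mul, ← mul_assoc, hb]⟩
  · rintro ⟨z, hz, hb⟩
    obtain ⟨w, u, hu, hyu⟩ := hX y z hz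
    exact ⟨u, hu, by rw [mul_assoc, ← map_mul, hyu, map_mul, ← mul_assoc, hb, zero_mul]⟩

/-- The pairs `(d, q)` with `b q = d b`. Since `b` and `q` lie in different rings, the relation is
expressed by writing `q` as a right fraction `a x⁻¹` with `x ∈ X` and clearing the denominator:
`b a = d b x`. -/
def intertwiner (hX : IsRightOre X) (φ : A →ₐ[k] B) (ι : A →ₐ[k] Q) (δ : D →ₐ[k] B) (b : B) :
    Subalgebra k (D × Q) where
  carrier := {p | ∃ a, ∃ x ∈ X, p.2 * ι x = ι a ∧ b * φ a = δ p.1 * b * φ x}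
  mul_mem' := by
    rintro ⟨d, q⟩ ⟨d', q'⟩ ⟨a, x, hx, hq, hd⟩ ⟨a', x', hx', hq', hd'⟩
    obtain ⟨w, u, hu, hw⟩ := hX a' x hx
    refine ⟨a * w, x' * u, mul_mem hx' hu, ?_, ?_⟩
    · calc q * q' * ι (x' * u) = q * (q' * ι x') * ι u := by simp only [map_mul, mul_assoc]
        _ = q * ι x * ι w := by rw [hq', mul_assoc, ← map_mul, hw, map_mul, mul_assoc]
        _ = ι (a * w) := by rw [hq, map_mul]
    · calc b * φ (a * w) = δ d * b * φ x * φ w := by rw [map_mul, ← mul_assoc, hd]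
        _ = δ d * (b * φ a') * φ u := by
          rw [mul_assoc, ← map_mul, ← hw, map_mul]; simp only [mul_assoc]
        _ = δ (d * d') * b * φ (x' * u) := by rw [hd']; simp only [map_mul, mul_assoc]
  add_mem' := by
    rintro ⟨d, q⟩ ⟨d', q'⟩ ⟨a, x, hx, hq, hd⟩ ⟨a', x', hx', hq', hd'⟩
    obtain ⟨w, u, hu, hw⟩ := hX x x' hx'
    refine ⟨a * u + a' * w, x * u, mul_mem hx hu, ?_, ?_⟩
    · calc (q + q') * ι (x * u) = q * ι x * ι u + q' * ι x' * ι w := by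
            rw [add_mul, mul_assoc, mul_assoc, ← map_mul, ← map_mul, hw]
        _ = ι (a * u + a' * w) := by rw [hq, hq', map_add, map_mul, map_mul]
    · calc b * φ (a * u + a' * w) = δ d * b * φ x * φ u + δ d' * b * φ x' * φ w := by
            rw [map_add, mul_add, map_mul, map_mul, ← mul_assoc, ← mul_assoc, hd, hd']
        _ = δ (d + d') * b * φ (x * u) := by
          rw [mul_assoc _ (φ x), mul_assoc _ (φ x'), ← map_mul, ← map_mul, ← hw, ← add_mul,
            ← add_mul, ← map_add]
  algebraMap_mem' c := by
    refine ⟨algebraMap k A c, 1, one_mem _, ?_, ?_⟩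
    · simp only [Prod.algebraMap_apply, map_one, mul_one, AlgHom.commutes]
    · simp only [Prod.algebraMap_apply, map_one, mul_one, AlgHom.commutes, Algebra.commutes]

variable {φ : A →ₐ[k] B} {ι : A →ₐ[k] Q} {δ : D →ₐ[k] B} {b : B}

theorem injective_fst_intertwiner (hX : IsRightOre X) (hφ : Function.Injective φ)
    (hι : ∀ x ∈ X, IsUnit (ι x)) (hb : IsLeftRegular b) :
    Function.Injective ((AlgHom.fst k D Q).comp (hX.intertwiner φ ι δ b).val) := by
  rw [injective_iff_map_eq_zero]
  rintro ⟨⟨_, q⟩, a, x, hx, hq, hd⟩ rfl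
  have ha : a = 0 := hφ <| hb <| by simpa using hd
  have hq0 : q = 0 := (hι x hx).mul_left_eq_zero.1 <| by rw [hq, ha, map_zero]
  exact Subtype.ext (Prod.ext rfl hq0)

end Intertwiner

theorem isPIAlgebra_of_forall_exists_mem_intertwiner {k A B D Q : Type*} [Field k] [Ring A]
    [Algebra k A] [Ring B] [Algebra k B] [Ring D] [Algebra k D] [Ring Q] [Algebra k Q]
    {X : Submonoid A} (hX : IsRightOre X) {φ : A →ₐ[k] B} {ι : A →ₐ[k] Q} {δ : D →ₐ[k] B} {b : B}
    (hD : IsPIAlgebra k D) (hφ : Function.Injective φ) (hι : ∀ x ∈ X, IsUnit (ι x))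
    (hb : IsLeftRegular b) {S : Subalgebra k Q}
    (hS : ∀ q ∈ S, ∃ d, (d, q) ∈ hX.intertwiner φ ι δ b) : IsPIAlgebra k S := by
  let J := hX.intertwiner φ ι δ b
  have hJ : IsPIAlgebra k J :=
    hD.of_injective ((AlgHom.fst k D Q).comp J.val) (hX.injective_fst_intertwiner hφ hι hb)
  let proj : J →ₐ[k] Q := (AlgHom.snd k D Q).comp J.val
  have hle : S ≤ proj.range := by
    intro q hq
    obtain ⟨d, hd⟩ := hS q hq
    exact (AlgHom.mem_range proj).2 ⟨⟨(d, q), hd⟩, rfl⟩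
  have hrange : IsPIAlgebra k proj.range :=
    hJ.of_surjective proj.rangeRestrict proj.rangeRestrict_surjective
  exact hrange.of_injective (Subalgebra.inclusion hle) (Subalgebra.inclusion_injective hle)

end IsRightOre

end RightOre

namespace IsGradedQuotientRing

theorem isRightOre {k A Q : Type*} [Field k] [Ring A] [Algebra k A] [Ring Q] [Algebra k Q]
    {𝒜 : ℕ → Submodule k A} [GradedAlgebra 𝒜] {ι : A →ₐ[k] Q} (h : IsGradedQuotientRing 𝒜 ι) :
    IsRightOre (homogeneousRegular 𝒜) := by
  intro a x hx
  obtain ⟨u, hu⟩ := h.isUnit x hx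
  obtain ⟨b, y, hy, hb⟩ := h.surj (↑u⁻¹ * ι a)
  refine ⟨b, y, hy, h.injective ?_⟩
  rw [map_mul, map_mul, ← hb, ← hu, ← mul_assoc, Units.mul_inv_cancel_left]

end IsGradedQuotientRing

theorem IsRightOre.exists_isGradedQuotientRing {k : Type*} {A : Type u} [Field k] [Ring A]
    [Algebra k A] {𝒜 : ℕ → Submodule k A} [GradedAlgebra 𝒜]
    (hOre : IsRightOre (homogeneousRegular 𝒜)) :
    ∃ (Q : Type u) (_ : Ring Q) (_ : Algebra k Q) (ι : A →ₐ[k] Q), IsGradedQuotientRing 𝒜 ι := by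
  obtain ⟨Q, hring, halg, ι, hinj, hunit, hsurj⟩ :=
    hOre.exists_algHom_rightFractions k fun x hx => hx.2
  exact ⟨Q, hring, halg, ι, hinj, hunit, hsurj⟩

namespace SkewPolyRing

variable {k D : Type*} [Field k] [Ring D] [Algebra k D] (σ : D ≃ₐ[k] D)

/-- The inclusion of `D` into `D[t;σ]` as the constant skew polynomials. -/
noncomputable def C : D →ₐ[k] SkewPolyRing σ where
  toFun := monomial σ 0
  map_one' := rfl
  map_mul' c d := by simp [monomial_mul_monomial]
  map_zero' := SkewPolynomial.monomial_zero_right 0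
  map_add' := monomial_add σ 0
  commutes' c := by
    rw [Algebra.algebraMap_eq_smul_one, ← smul_monomial, Algebra.algebraMap_eq_smul_one]
    rfl

theorem C_mul_monomial (n : ℕ) (c d : D) : C σ c * monomial σ n d = monomial σ n (c * d) :=
  (monomial_mul_monomial σ 0 n c d).trans (by simp)

/-- The map `d ↦ d tⁿ`, as a homomorphism of left `D`-modules; `D` acts on `D[t;σ]` through
`SkewPolyRing.C`. -/
noncomputable def monomialₛₗ (n : ℕ) : D →ₛₗ[(C σ : D →+* SkewPolyRing σ)] SkewPolyRing σ where
  toFun := monomial σ n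
  map_add' := monomial_add σ n
  map_smul' c d := (C_mul_monomial σ n c d).symm

theorem monomial_one_mul_monomial (m n : ℕ) (d : D) :
    monomial σ m 1 * monomial σ n d = monomial σ (m + n) ((σ ^ m) d) := by
  rw [monomial_mul_monomial, one_mul]

theorem isLeftRegular_monomial_one (n : ℕ) : IsLeftRegular (monomial σ n 1) := by
  let _ := powersAction σ
  refine fun f g hfg => SkewMonoidAlgebra.ext fun m => (σ ^ n).injective ?_
  have hcoeff (p : SkewMonoidAlgebra D (Multiplicative ℕ)) :
      (SkewMonoidAlgebra.single (Multiplicative.ofAdd n) (1 : D) * p).coeff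
        (Multiplicative.ofAdd n * m) = (σ ^ n) (p.coeff m) := by
    rw [p.coeff_single_mul_aux fun a => mul_right_inj (b := a) (c := m) _, one_mul]
    rfl
  exact (hcoeff f).symm.trans
    ((congrArg (fun p : SkewMonoidAlgebra D _ => p.coeff _) hfg).trans (hcoeff g))

variable {σ} {A : Subalgebra k (SkewPolyRing σ)} {X : Submonoid A}

/-- The left ideal of the coefficients `c` for which `c tⁿ` is annihilated on the right by an
element of the right Ore set `X` of `A`. -/
noncomputable def torsionCoeff (hX : IsRightOre X) (n : ℕ) : Submodule D D :=
  (hX.torsion A.val).comap (monomialₛₗ σ n)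

theorem comap_toSpanSingleton_torsionCoeff (hX : IsRightOre X) {y : A} (hy : y ∈ X) {p : ℕ}
    {e : D} (he : monomial σ p e = y) (n : ℕ) :
    (torsionCoeff hX (n + p)).comap (LinearMap.toSpanSingleton D D ((σ ^ n) e)) =
      torsionCoeff hX n := by
  ext c
  change monomial σ (n + p) (c * (σ ^ n) e) ∈ hX.torsion A.val ↔
    monomial σ n c ∈ hX.torsion A.val
  rw [← monomial_mul_monomial, he]
  exact hX.mul_mem_torsion_iff A.val hy

theorem exists_forall_sub_mem_torsionCoeff [IsArtinianRing D] (hX : IsRightOre X) :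
    ∃ n, ∀ y ∈ X, ∀ (p : ℕ) (e : D), monomial σ p e = y →
      ∀ a, ∃ d, d * (σ ^ n) e - a ∈ torsionCoeff hX (n + p) := by
  obtain ⟨n, hn⟩ := exists_forall_length_quotient_le (torsionCoeff hX)
  refine ⟨n, fun y hy p e he a => ?_⟩
  let T := torsionCoeff hX (n + p)
  let rightMul : D →ₗ[D] D ⧸ T := T.mkQ ∘ₗ LinearMap.toSpanSingleton D D ((σ ^ n) e)
  have hker : LinearMap.ker rightMul = torsionCoeff hX n := by
    rw [LinearMap.ker_comp, T.ker_mkQ, comap_toSpanSingleton_torsionCoeff hX hy he]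
  have hsurj : Function.Surjective rightMul :=
    surjective_of_length_le_length_quotient_ker _ (hker ▸ hn (n + p))
  obtain ⟨d, hd⟩ := hsurj (T.mkQ a)
  exact ⟨d, (Submodule.Quotient.eq T).1 hd⟩

variable [GradedAlgebra (gradedPiece A)] {Q : Type*} [Ring Q] [Algebra k Q] {ι : A →ₐ[k] Q}

theorem exists_forall_mem_intertwiner [IsArtinianRing D]
    (h : IsGradedQuotientRing (gradedPiece A) ι) :
    ∃ n, ∀ q ∈ h.degreeZero, ∃ d,
      (d, q) ∈ h.isRightOre.intertwiner A.val ι (C σ) (monomial σ n 1) := by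
  obtain ⟨n, hn⟩ := exists_forall_sub_mem_torsionCoeff h.isRightOre
  refine ⟨n, ?_⟩
  rintro q ⟨p, a, ⟨c, hc : monomial σ p c = a⟩, x, ⟨e, he : monomial σ p e = x⟩, hx, hq⟩
  obtain ⟨d, z, hz, hdz⟩ := hn x hx p e he ((σ ^ n) c)
  have hd : (C σ d * monomial σ n 1 * x - monomial σ n 1 * a) * (z : SkewPolyRing σ) = 0 := by
    rw [← he, ← hc, mul_assoc, monomial_one_mul_monomial, monomial_one_mul_monomial,
      C_mul_monomial]
    exact (map_sub (monomialₛₗ σ (n + p)) _ _) ▸ hdz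
  refine ⟨d, a * z, x * z, mul_mem hx hz, by rw [map_mul, ← mul_assoc, hq, map_mul], ?_⟩
  rw [sub_mul, sub_eq_zero] at hd
  simpa only [map_mul, mul_assoc, Subalgebra.coe_val] using hd.symm

theorem isPIAlgebra_degreeZero [IsArtinianRing D] (hD : IsPIAlgebra k D)
    (h : IsGradedQuotientRing (gradedPiece A) ι) : IsPIAlgebra k h.degreeZero := by
  obtain ⟨n, hn⟩ := exists_forall_mem_intertwiner h
  exact h.isRightOre.isPIAlgebra_of_forall_exists_mem_intertwiner hD Subtype.val_injective
    h.isUnit (isLeftRegular_monomial_one σ n) hn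

end SkewPolyRing

theorem mainTheorem10_general {k D : Type*} [Field k] [Ring D] [Algebra k D] [IsArtinianRing D]
    (hD : IsPIAlgebra k D) (σ : D ≃ₐ[k] D) (A : Subalgebra k (SkewPolyRing σ))
    [GradedAlgebra (SkewPolyRing.gradedPiece A)]
    (hOre : IsRightOre (homogeneousRegular (SkewPolyRing.gradedPiece A))) :
    IsBirationallyPI (SkewPolyRing.gradedPiece A) := by
  obtain ⟨Q, hring, halg, ι, hι⟩ := hOre.exists_isGradedQuotientRing
  exact ⟨Q, hring, halg, ι, hι, SkewPolyRing.isPIAlgebra_degreeZero hD hι⟩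

theorem mainTheorem10 {k D : Type*} [Field k] [Ring D] [Algebra k D]
    [IsSemisimpleRing D] [Module.Finite (Subalgebra.center k D) D]
    (σ : D ≃ₐ[k] D)
    (A : Subalgebra k (SkewPolyRing σ)) [GradedAlgebra (SkewPolyRing.gradedPiece A)]
    (hsemiprime : IsSemiprimeRing A) (hnoeth : IsTwoSidedNoetherianRing A)
    (hOre : IsRightOre (homogeneousRegular (SkewPolyRing.gradedPiece A))) :
    IsBirationallyPI (SkewPolyRing.gradedPiece A) :=
  mainTheorem10_general (IsPIAlgebra.of_finite_center k D) σ A hOre
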